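/- For a probability distribution $\mu$ on $\mathbb{N}$ and $m\ge 1$, let $X=(X_1,\dots,X_m)\sim\mu^m$ be an i.i.d. sample, let $\hat\mu_m(i)=\frac1m\sum_{t=1}^m \mathbf 1[X_t=i]$ be the empirical measure, let $\|\mu-\nu\|_{TV}=\frac12\sum_i|\mu(i)-\nu(i)|$, and let $\Phi_m(\nu)=\frac1{\sqrt m}\sum_{j}\sqrt{\nu(j)}$. An estimator–bound pair is a sequence $(\tilde\mu_m,\Psi_m)_{m\ge1}$, where $\tilde\mu_m$ maps samples in $\mathbb{N}^m$ to probability distributions on $\mathbb{N}$, and $\Psi_m$ maps probability distributions on $\mathbb{N}$ to real numbers. There exist universal constants $a,b>0$ such that the following holds. Let $(\tilde\mu_m,\Psi_m)_{m\ge1}$ be any estimator–bound pair and let $\theta:[0,\infty)\to[0,\infty)$ be any continuous function such that, for all $m\ge1$ and all probability distributions $\mu$ on $\mathbb{N}$, the expectation $\mathbb{E}\,\Psi_m(\tilde\mu_m)$ exists and is finite and $$\mathbb{E}\,\|\tilde\mu_m-\mu\|_{TV}\;\le\;\mathbb{E}\,\Psi_m(\tilde\mu_m)\;\le\;\theta\big(\mathbb{E}\,\Phi_m(\hat\mu_m)\big),$$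 where $\tilde\mu_m=\tilde\mu_m(X)$ and the expectations are over $X\sim\mu^m$. Then $$\inf_{0<x<b}\frac{\theta(x)}{x}\;\ge\;\frac1a .$$ -/

import Mathlib

open MeasureTheory
open scoped ENNReal NNReal

noncomputable section

namespace TVEstimation

/-- The law `μ^m` of an i.i.d. sample `X = (X₁, …, X_m)` from `μ`. -/
def sampleLaw (m : ℕ) (μ : PMF ℕ) : Measure (Fin m → ℕ) :=
  Measure.pi fun _ => μ.toMeasure

/-- The total variation distance `½ ∑ᵢ |μ(i) - ν(i)|`. -/
def tv (μ ν : PMF ℕ) : ℝ :=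
  (1 / 2) * ∑' i, |(μ i).toReal - (ν i).toReal|

/-- The empirical measure (MLE) `i ↦ (1/m) ∑ₜ 𝟙[X_t = i]` of a sample of size `m ≥ 1`. -/
def empirical {m : ℕ} [NeZero m] (X : Fin m → ℕ) : PMF ℕ :=
  ⟨fun i => (∑ t : Fin m, if X t = i then 1 else 0) / (m : ℝ≥0∞), by
    rw [ENNReal.summable.hasSum_iff]
    simp only [div_eq_mul_inv]
    rw [ENNReal.tsum_mul_right, Summable.tsum_finsetSum fun _ _ => ENNReal.summable]
    have h : ∀ t : Fin m, (∑' i, if X t = i then (1 : ℝ≥0∞) else 0) = 1 := by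
      intro t
      rw [tsum_eq_single (X t) (fun i hi => if_neg (Ne.symm hi)), if_pos rfl]
    simp only [h, Finset.sum_const, Finset.card_univ, Fintype.card_fin, nsmul_eq_mul, mul_one]
    exact ENNReal.mul_inv_cancel (by exact_mod_cast NeZero.ne m) (ENNReal.natCast_ne_top m)⟩

/-- The half-norm `(∑ᵢ √μ(i))²`, possibly infinite. -/
def halfNorm (μ : PMF ℕ) : ℝ≥0∞ :=
  (∑' i, (μ i) ^ (1 / 2 : ℝ)) ^ 2

/-- `Φ_m(ν) = (1/√m) ‖ν‖_{1/2}^{1/2}`, possibly infinite. -/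
def Phi (m : ℕ) (ν : PMF ℕ) : ℝ≥0∞ :=
  halfNorm ν ^ (1 / 2 : ℝ) / (m : ℝ≥0∞) ^ (1 / 2 : ℝ)

/-- The expectation of `Φ_m` at the empirical measure of an i.i.d. sample of size `m` from `μ`. -/
def expectedPhi (m : ℕ) [NeZero m] (μ : PMF ℕ) : ℝ≥0∞ :=
  ∫⁻ X, Phi m (empirical X) ∂(sampleLaw m μ)

instance (m : ℕ) (μ : PMF ℕ) : IsProbabilityMeasure (sampleLaw m μ) := by
  unfold sampleLaw; infer_instance

/-- `Φ_m` of an empirical measure is at most `1`. -/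
theorem Phi_empirical_le_one {m : ℕ} [NeZero m] (X : Fin m → ℕ) : Phi m (empirical X) ≤ 1 := by
  have hm0 : (m : ℝ≥0∞) ≠ 0 := by exact_mod_cast NeZero.ne m
  have hmt : (m : ℝ≥0∞) ≠ ∞ := ENNReal.natCast_ne_top m
  have key : ∀ i, (empirical X i) ^ (1 / 2 : ℝ) ≤
      (m : ℝ≥0∞) ^ (1 / 2 : ℝ) * empirical X i := by
    intro i
    have he : empirical X i =
      ((Finset.univ.filter fun t => X t = i).card : ℝ≥0∞) / m := by
      change (∑ t : Fin m, if X t = i then (1 : ℝ≥0∞) else 0) / (m : ℝ≥0∞) = _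
      rw [Finset.sum_boole]
    rw [he]
    set k := (Finset.univ.filter fun t => X t = i).card
    rcases Nat.eq_zero_or_pos k with hk | hk
    · simp [hk]
    · have hk1 : (1 : ℝ≥0∞) ≤ k := by exact_mod_cast hk
      rw [ENNReal.div_rpow_of_nonneg _ _ (by norm_num)]
      have h1 : (k : ℝ≥0∞) ^ (1 / 2 : ℝ) ≤ k := by
        calc (k : ℝ≥0∞) ^ (1 / 2 : ℝ) ≤ (k : ℝ≥0∞) ^ (1 : ℝ) :=
              ENNReal.rpow_le_rpow_of_exponent_le hk1 (by norm_num)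
          _ = k := ENNReal.rpow_one _
      have h2 : (m : ℝ≥0∞) ^ (1 / 2 : ℝ) * (m : ℝ≥0∞)⁻¹ = ((m : ℝ≥0∞) ^ (1 / 2 : ℝ))⁻¹ := by
        rw [← ENNReal.rpow_neg_one, ← ENNReal.rpow_add _ _ hm0 hmt, ← ENNReal.rpow_neg]
        norm_num
      calc (k : ℝ≥0∞) ^ (1 / 2 : ℝ) / (m : ℝ≥0∞) ^ (1 / 2 : ℝ)
          ≤ k * ((m : ℝ≥0∞) ^ (1 / 2 : ℝ))⁻¹ := by
            rw [div_eq_mul_inv]; exact mul_le_mul_left h1 _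
        _ = (m : ℝ≥0∞) ^ (1 / 2 : ℝ) * (k / m) := by
            rw [← h2, mul_left_comm, ← div_eq_mul_inv]
  have hsum : ∑' i, (empirical X i) ^ (1 / 2 : ℝ) ≤ (m : ℝ≥0∞) ^ (1 / 2 : ℝ) := by
    calc ∑' i, (empirical X i) ^ (1 / 2 : ℝ)
        ≤ ∑' i, (m : ℝ≥0∞) ^ (1 / 2 : ℝ) * empirical X i := ENNReal.tsum_le_tsum key
      _ = (m : ℝ≥0∞) ^ (1 / 2 : ℝ) := by
          rw [ENNReal.tsum_mul_left, (empirical X).tsum_coe, mul_one]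
  unfold Phi halfNorm
  rw [← ENNReal.rpow_natCast, ← ENNReal.rpow_mul]
  norm_num only [Nat.cast_ofNat, ENNReal.rpow_one]
  norm_num at hsum ⊢
  exact ENNReal.div_le_of_le_mul (by simpa using hsum)

/-- The expectation of `Φ_m` is always finite. -/
theorem expectedPhi_ne_top (m : ℕ) [NeZero m] (μ : PMF ℕ) : expectedPhi m μ ≠ ∞ := by
  refine ne_top_of_le_ne_top ENNReal.one_ne_top ?_
  calc expectedPhi m μ ≤ ∫⁻ _, 1 ∂(sampleLaw m μ) := lintegral_mono Phi_empirical_le_one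
    _ = 1 := by simp

end TVEstimation

end

namespace TVEstimation

/-! Two distributions that are hard to tell apart from `m` samples but share the value `x` of
`expectedPhi` force `2 θ(x)` to exceed the sum of their estimation risks. `pairPMF ε q` and `pairPMF
(-ε) q` differ by swapping `0` and `1`, so they share `expectedPhi`, while their distance is `ε /
2`. When `m ε² ≤ 1/2`, Le Cam's argument bounds the risk sum below by `ε / 8`
(`div_eight_le_integral_tv_add_integral_tv`).

The parameter `q` makes the common value exactly `x`: it is at most `√3/√m` at `q = 0`, at least
`2/√m` at `q = 1`, and polynomial in `q`. Given `x < 1/4`, some `m` puts `x√m` in `[√3, 2]`; then `ε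
= x/4` gives `θ(x) ≥ x/64`. -/

/-! ### Expectations under finitely supported laws, and bounds on `Phi` -/

theorem integral_sampleLaw {m : ℕ} {μ : PMF ℕ} {s : Finset ℕ} (h : ∀ i ∉ s, μ i = 0)
    (f : (Fin m → ℕ) → ℝ) :
    ∫ X, f X ∂(sampleLaw m μ) =
      ∑ X ∈ Fintype.piFinset (fun _ : Fin m => s), (∏ t, (μ (X t)).toReal) * f X := by
  have hsing : ∀ X : Fin m → ℕ, sampleLaw m μ {X} = ∏ t, μ (X t) := by
    intro X
    rw [sampleLaw, Measure.pi_singleton]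
    refine Finset.prod_congr rfl fun t _ => ?_
    exact μ.toMeasure_apply_singleton _ (measurableSet_singleton _)
  have hz : sampleLaw m μ (↑(Fintype.piFinset (fun _ : Fin m => s)) : Set (Fin m → ℕ))ᶜ = 0 := by
    rw [← Set.biUnion_of_singleton (↑(Fintype.piFinset (fun _ : Fin m => s)) : Set (Fin m → ℕ))ᶜ,
      measure_biUnion_null_iff (Set.to_countable _)]
    intro X hX
    have hX' : ∃ t, X t ∉ s := by simpa using hX
    obtain ⟨t, ht⟩ := hX'
    rw [hsing]
    exact Finset.prod_eq_zero (Finset.mem_univ t) (h _ ht)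
  rw [← setIntegral_eq_integral_of_ae_compl_eq_zero
    (s := (↑(Fintype.piFinset (fun _ : Fin m => s)) : Set (Fin m → ℕ))),
    setIntegral_finset]
  · refine Finset.sum_congr rfl fun X _ => ?_
    rw [smul_eq_mul, measureReal_def, hsing, ENNReal.toReal_prod]
  · exact IntegrableOn.finset
  · refine (measure_eq_zero_iff_ae_notMem.1 hz).mono fun X hX hX' => absurd hX' (by simpa using hX)

theorem toReal_empirical {m : ℕ} [NeZero m] (X : Fin m → ℕ) (j : ℕ) :
    (empirical X j).toReal = (∑ t : Fin m, if X t = j then (1 : ℝ) else 0) / m := by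
  change ((∑ t : Fin m, if X t = j then (1 : ℝ≥0∞) else 0) / (m : ℝ≥0∞)).toReal = _
  rw [ENNReal.toReal_div, ENNReal.toReal_sum]
  · simp [apply_ite ENNReal.toReal]
  · intro t _; split_ifs <;> simp

theorem empirical_eq_zero {m : ℕ} [NeZero m] {X : Fin m → ℕ} {j : ℕ} (h : ∀ t, X t ≠ j) :
    empirical X j = 0 := by
  change ((∑ t : Fin m, if X t = j then (1 : ℝ≥0∞) else 0) / (m : ℝ≥0∞)) = _
  simp [h]

theorem Phi_eq_tsum (m : ℕ) (ν : PMF ℕ) :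
    Phi m ν = (∑' i, (ν i) ^ (1 / 2 : ℝ)) / (m : ℝ≥0∞) ^ (1 / 2 : ℝ) := by
  unfold Phi halfNorm
  rw [← ENNReal.rpow_natCast, ← ENNReal.rpow_mul]
  norm_num

theorem toReal_Phi_empirical {m : ℕ} [NeZero m] {X : Fin m → ℕ} {s : Finset ℕ}
    (hX : ∀ t, X t ∈ s) :
    (Phi m (empirical X)).toReal =
      (∑ j ∈ s, √(empirical X j).toReal) / √m := by
  rw [Phi_eq_tsum, tsum_eq_sum (s := s), ENNReal.toReal_div, ENNReal.toReal_sum]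
  · simp [← ENNReal.toReal_rpow, Real.sqrt_eq_rpow]
  · intro j _
    exact ENNReal.rpow_ne_top_of_nonneg (by norm_num) (PMF.apply_ne_top _ _)
  · intro j hj
    rw [empirical_eq_zero (X := X) (j := j) fun t ht => hj (ht ▸ hX t)]
    simp

theorem sum_empirical {m : ℕ} [NeZero m] {X : Fin m → ℕ} {s : Finset ℕ}
    (hX : ∀ t, X t ∈ s) : ∑ j ∈ s, (empirical X j).toReal = 1 := by
  have h := (empirical X).tsum_coe
  have hz : ∀ j ∉ s, empirical X j = 0 := fun j hj =>
    empirical_eq_zero fun t ht => hj (ht ▸ hX t)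
  rw [tsum_eq_sum hz] at h
  rw [← ENNReal.toReal_sum fun j _ => PMF.apply_ne_top _ _, h, ENNReal.toReal_one]

theorem toReal_Phi_empirical_le {m : ℕ} [NeZero m] {X : Fin m → ℕ} {s : Finset ℕ}
    (hX : ∀ t, X t ∈ s) : (Phi m (empirical X)).toReal ≤ √s.card / √m := by
  rw [toReal_Phi_empirical hX]
  gcongr
  refine Real.le_sqrt_of_sq_le ?_
  calc (∑ j ∈ s, √(empirical X j).toReal) ^ 2
      ≤ s.card * ∑ j ∈ s, √(empirical X j).toReal ^ 2 := sq_sum_le_card_mul_sum_sq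
    _ = s.card := by
      simp only [Real.sq_sqrt ENNReal.toReal_nonneg, sum_empirical hX, mul_one]

/-- With `v = u²` the difference is `u (2u - 1)² (u + 1)`. Tangency at `v = 1/4` makes the resulting
bound on `Phi` sharp for four equal atoms. -/
theorem three_mul_sub_le_sqrt {v : ℝ} (hv : 0 ≤ v) : 3 * v - 4 * v ^ 2 ≤ √v := by
  obtain ⟨u, hu, rfl⟩ : ∃ u, 0 ≤ u ∧ v = u ^ 2 := ⟨√v, Real.sqrt_nonneg _, (Real.sq_sqrt hv).symm⟩
  rw [Real.sqrt_sq hu]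
  nlinarith [mul_nonneg hu (mul_nonneg (sq_nonneg (2 * u - 1)) (by linarith : 0 ≤ u + 1))]

theorem le_toReal_Phi_empirical {m : ℕ} [NeZero m] {X : Fin m → ℕ} {s : Finset ℕ}
    (hX : ∀ t, X t ∈ s) :
    (3 - 4 * ∑ j ∈ s, (empirical X j).toReal ^ 2) / √m ≤ (Phi m (empirical X)).toReal := by
  rw [toReal_Phi_empirical hX]
  gcongr
  calc 3 - 4 * ∑ j ∈ s, (empirical X j).toReal ^ 2
      = ∑ j ∈ s, (3 * (empirical X j).toReal - 4 * (empirical X j).toReal ^ 2) := by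
        rw [Finset.sum_sub_distrib, ← Finset.mul_sum, ← Finset.mul_sum, sum_empirical hX, mul_one]
    _ ≤ _ := Finset.sum_le_sum fun j _ => three_mul_sub_le_sqrt ENNReal.toReal_nonneg

theorem toReal_expectedPhi {m : ℕ} [NeZero m] {μ : PMF ℕ} {s : Finset ℕ}
    (h : ∀ i ∉ s, μ i = 0) :
    (expectedPhi m μ).toReal = ∑ X ∈ Fintype.piFinset (fun _ : Fin m => s),
      (∏ t, (μ (X t)).toReal) * (Phi m (empirical X)).toReal := by
  rw [← integral_sampleLaw h, expectedPhi, integral_toReal]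
  · exact (measurable_of_countable _).aemeasurable
  · exact Filter.Eventually.of_forall fun X =>
      (Phi_empirical_le_one X).trans_lt ENNReal.one_lt_top

theorem Phi_empirical_comp {m : ℕ} [NeZero m] (e : ℕ ≃ ℕ) (X : Fin m → ℕ) :
    Phi m (empirical (e ∘ X)) = Phi m (empirical X) := by
  rw [Phi_eq_tsum, Phi_eq_tsum, ← e.tsum_eq fun i => (empirical (e ∘ X) i) ^ (1 / 2 : ℝ)]
  have h : ∀ i, empirical (e ∘ X) (e i) = empirical X i := by
    intro i
    change ((∑ t : Fin m, if (e ∘ X) t = e i then (1 : ℝ≥0∞) else 0) / (m : ℝ≥0∞)) =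
      ((∑ t : Fin m, if X t = i then (1 : ℝ≥0∞) else 0) / (m : ℝ≥0∞))
    simp
  simp only [h]

theorem expectedPhi_congr_of_equiv {m : ℕ} [NeZero m] {μ ν : PMF ℕ} (e : ℕ ≃ ℕ)
    (h : ∀ i, ν (e i) = μ i) : expectedPhi m ν = expectedPhi m μ := by
  have key : ∀ (μ : PMF ℕ), expectedPhi m μ =
      ∑' X : Fin m → ℕ, Phi m (empirical X) * ∏ t, μ (X t) := by
    intro μ
    rw [expectedPhi, lintegral_countable']
    refine tsum_congr fun X => ?_
    rw [sampleLaw, Measure.pi_singleton]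
    congr 1
    exact Finset.prod_congr rfl fun t _ =>
      μ.toMeasure_apply_singleton _ (measurableSet_singleton _)
  rw [key, key, ← (Equiv.arrowCongr (Equiv.refl (Fin m)) e).tsum_eq]
  refine tsum_congr fun X => ?_
  have hX : Equiv.arrowCongr (Equiv.refl (Fin m)) e X = e ∘ X := by
    ext t; simp [Equiv.arrowCongr]
  rw [hX, Phi_empirical_comp]
  simp [h]

/-! ### Collision probabilities of the sample -/

theorem sum_piFinset_prod_ite_mul_ite {m : ℕ} {s : Finset ℕ} {w : ℕ → ℝ}
    (hw : ∑ i ∈ s, w i = 1) {j : ℕ} (hj : j ∈ s) {t u : Fin m} (htu : t ≠ u) :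
    ∑ X ∈ Fintype.piFinset (fun _ : Fin m => s), (∏ v, w (X v)) *
      ((if X t = j then 1 else 0) * (if X u = j then 1 else 0)) = w j ^ 2 := by
  have h1 : ∀ X : Fin m → ℕ, (∏ v, w (X v)) *
      ((if X t = j then (1 : ℝ) else 0) * (if X u = j then 1 else 0)) =
      ∏ v, w (X v) * ((if v = t then if X v = j then 1 else 0 else 1) *
        (if v = u then if X v = j then 1 else 0 else 1)) := by
    intro X
    rw [Finset.prod_mul_distrib, Finset.prod_mul_distrib]
    simp
  simp only [h1]
  rw [← Finset.prod_univ_sum (fun _ : Fin m => s) fun v i => w i *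
    ((if v = t then if i = j then 1 else 0 else 1) *
        (if v = u then if i = j then 1 else 0 else 1)),
    Finset.prod_eq_mul t u htu]
  · simp [htu, htu.symm, hj, sq]
  · intro v _ hv
    simp [hv.1, hv.2, hw]
  · simp
  · simp

theorem sum_piFinset_prod {m : ℕ} (s : Finset ℕ) (w : ℕ → ℝ) :
    ∑ X ∈ Fintype.piFinset (fun _ : Fin m => s), ∏ v, w (X v) = (∑ i ∈ s, w i) ^ m := by
  rw [← Finset.prod_univ_sum (fun _ : Fin m => s) fun _ i => w i]
  simp

/-- Times `m²`, the sum of squares counts ordered pairs `(t, u)` with `X t = X u`. The `m` diagonal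
pairs always collide; each other pair does so with probability `∑ w j ^ 2`. -/
theorem sum_prod_mul_sum_empirical_sq_le {m : ℕ} [NeZero m] {s : Finset ℕ} {w : ℕ → ℝ}
    (hw : ∑ i ∈ s, w i = 1) :
    ∑ X ∈ Fintype.piFinset (fun _ : Fin m => s), (∏ t, w (X t)) *
      ∑ j ∈ s, (empirical X j).toReal ^ 2 ≤ 1 / m + ∑ j ∈ s, w j ^ 2 := by
  have hm : (0 : ℝ) < m := by exact_mod_cast NeZero.pos m
  set S := Fintype.piFinset (fun _ : Fin m => s)
  have hpair : ∀ t u : Fin m, ∑ X ∈ S, (∏ v, w (X v)) * ∑ j ∈ s,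
      ((if X t = j then (1 : ℝ) else 0) * (if X u = j then 1 else 0)) ≤
      (if t = u then 1 else 0) + ∑ j ∈ s, w j ^ 2 := by
    intro t u
    by_cases htu : t = u
    · subst htu
      have h1 : ∀ X ∈ S, (∏ v, w (X v)) * ∑ j ∈ s,
          ((if X t = j then (1 : ℝ) else 0) * (if X t = j then 1 else 0)) = ∏ v, w (X v) := by
        intro X hX
        have : X t ∈ s := Fintype.mem_piFinset.1 hX t
        simp [this]
      rw [Finset.sum_congr rfl h1, sum_piFinset_prod, hw]
      simpa using Finset.sum_nonneg fun j _ => sq_nonneg (w j)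
    · simp only [Finset.mul_sum]
      rw [Finset.sum_comm, if_neg htu, zero_add]
      exact (Finset.sum_congr rfl fun j hj => sum_piFinset_prod_ite_mul_ite hw hj htu).le
  have hexp : ∀ X : Fin m → ℕ, (∏ t, w (X t)) * ∑ j ∈ s, (empirical X j).toReal ^ 2 =
      (∑ t, ∑ u, (∏ v, w (X v)) * ∑ j ∈ s,
        ((if X t = j then (1 : ℝ) else 0) * (if X u = j then 1 else 0))) / (m : ℝ) ^ 2 := by
    intro X
    simp only [← Finset.mul_sum]
    rw [mul_div_assoc]
    congr 1
    simp only [toReal_empirical, div_pow, ← Finset.sum_div]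
    congr 1
    simp only [sq, Finset.sum_mul_sum]
    rw [Finset.sum_comm]
    refine Finset.sum_congr rfl fun t _ => ?_
    rw [Finset.sum_comm]
  simp only [hexp]
  rw [← Finset.sum_div, div_le_iff₀ (by positivity), Finset.sum_comm]
  calc _ ≤ ∑ t : Fin m, ∑ u : Fin m, ((if t = u then 1 else 0) + ∑ j ∈ s, w j ^ 2) := by
        refine Finset.sum_le_sum fun t _ => ?_
        rw [Finset.sum_comm]
        exact Finset.sum_le_sum fun u _ => hpair t u
    _ = _ := by
        simp only [Finset.sum_add_distrib, Finset.sum_ite_eq, Finset.mem_univ, if_true,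
          Finset.sum_const, Finset.card_univ, Fintype.card_fin, nsmul_eq_mul, mul_one]
        field_simp

/-! ### Le Cam's two-point method -/

theorem summable_abs_sub (μ ν : PMF ℕ) : Summable fun i => |(μ i).toReal - (ν i).toReal| :=
  ((ENNReal.summable_toReal μ.tsum_coe_ne_top).sub
    (ENNReal.summable_toReal ν.tsum_coe_ne_top)).abs

theorem tv_nonneg (μ ν : PMF ℕ) : 0 ≤ tv μ ν :=
  mul_nonneg (by norm_num) (tsum_nonneg fun _ => abs_nonneg _)

theorem tv_le_tv_add_tv (ρ μ ν : PMF ℕ) : tv μ ν ≤ tv ρ μ + tv ρ ν := by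
  unfold tv
  rw [← mul_add, ← (summable_abs_sub ρ μ).tsum_add (summable_abs_sub ρ ν)]
  gcongr with i
  · exact summable_abs_sub μ ν
  · exact (summable_abs_sub ρ μ).add (summable_abs_sub ρ ν)
  · rw [abs_sub_comm (ρ i).toReal (μ i).toReal]
    exact abs_sub_le _ _ _

/-- Le Cam's two-point bound, with `r` a pointwise lower bound of the geometric mean. -/
theorem tv_mul_le_integral_add_integral {m : ℕ} {μ ν : PMF ℕ} {s : Finset ℕ} {r : ℕ → ℝ}
    (hμ : ∀ i ∉ s, μ i = 0) (hν : ∀ i ∉ s, ν i = 0)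
    (hrle : ∀ i ∈ s, r i ^ 2 ≤ (μ i).toReal * (ν i).toReal)
    (est : (Fin m → ℕ) → PMF ℕ) :
    tv μ ν * ((∑ i ∈ s, r i) ^ m) ^ 2 / 2 ≤
      ∫ X, tv (est X) μ ∂(sampleLaw m μ) + ∫ X, tv (est X) ν ∂(sampleLaw m ν) := by
  have hsum : ∀ {ρ : PMF ℕ}, (∀ i ∉ s, ρ i = 0) → ∑ i ∈ s, (ρ i).toReal = 1 := by
    intro ρ h
    rw [← ENNReal.toReal_sum fun j _ => PMF.apply_ne_top _ _, ← tsum_eq_sum (L := .unconditional ℕ) h, ρ.tsum_coe,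
      ENNReal.toReal_one]
  rw [integral_sampleLaw hμ, integral_sampleLaw hν, ← sum_piFinset_prod]
  set S := Fintype.piFinset (fun _ : Fin m => s)
  set P : (Fin m → ℕ) → ℝ := fun X => ∏ t, (μ (X t)).toReal
  set Q : (Fin m → ℕ) → ℝ := fun X => ∏ t, (ν (X t)).toReal
  have hP : ∀ X, 0 ≤ P X := fun X => Finset.prod_nonneg fun _ _ => ENNReal.toReal_nonneg
  have hQ : ∀ X, 0 ≤ Q X := fun X => Finset.prod_nonneg fun _ _ => ENNReal.toReal_nonneg
  have hPs : ∑ X ∈ S, P X = 1 := by rw [sum_piFinset_prod s fun i => (μ i).toReal, hsum hμ, one_pow]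
  have hQs : ∑ X ∈ S, Q X = 1 := by rw [sum_piFinset_prod s fun i => (ν i).toReal, hsum hν, one_pow]
  -- Cauchy–Schwarz applied to `P Q = min(P, Q) · max(P, Q)`; the maxima sum to at most `2`.
  have hcs : (∑ X ∈ S, ∏ v, r (X v)) ^ 2 ≤ (∑ X ∈ S, min (P X) (Q X)) * 2 := by
    calc (∑ X ∈ S, ∏ v, r (X v)) ^ 2
        ≤ (∑ X ∈ S, min (P X) (Q X)) * ∑ X ∈ S, max (P X) (Q X) := by
          refine Finset.sum_sq_le_sum_mul_sum_of_sq_le_mul S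
            (fun X _ => le_min (hP X) (hQ X)) (fun X _ => (hP X).trans (le_max_left _ _))
            fun X hX => ?_
          rw [min_mul_max, ← Finset.prod_mul_distrib, ← Finset.prod_pow]
          exact Finset.prod_le_prod (fun _ _ => sq_nonneg _)
            fun t _ => hrle _ (Fintype.mem_piFinset.1 hX t)
      _ ≤ (∑ X ∈ S, min (P X) (Q X)) * ∑ X ∈ S, (P X + Q X) := by
          exact mul_le_mul_of_nonneg_left
            (Finset.sum_le_sum fun X _ => max_le_add_of_nonneg (hP X) (hQ X))
            (Finset.sum_nonneg fun X _ => le_min (hP X) (hQ X))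
      _ = _ := by rw [Finset.sum_add_distrib, hPs, hQs]; norm_num
  calc tv μ ν * (∑ X ∈ S, ∏ v, r (X v)) ^ 2 / 2
      ≤ tv μ ν * ((∑ X ∈ S, min (P X) (Q X)) * 2) / 2 := by
        gcongr
        exact tv_nonneg _ _
    _ = ∑ X ∈ S, min (P X) (Q X) * tv μ ν := by rw [← Finset.sum_mul]; ring
    _ ≤ ∑ X ∈ S, (P X * tv (est X) μ + Q X * tv (est X) ν) := by
        refine Finset.sum_le_sum fun X _ => ?_
        calc min (P X) (Q X) * tv μ ν
            ≤ min (P X) (Q X) * tv (est X) μ + min (P X) (Q X) * tv (est X) ν := by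
              rw [← mul_add]
              exact mul_le_mul_of_nonneg_left (tv_le_tv_add_tv _ _ _) (le_min (hP X) (hQ X))
          _ ≤ _ := add_le_add
              (mul_le_mul_of_nonneg_right (min_le_left _ _) (tv_nonneg _ _))
              (mul_le_mul_of_nonneg_right (min_le_right _ _) (tv_nonneg _ _))
    _ = _ := Finset.sum_add_distrib

/-! ### The family of hard pairs -/

/-- Half of the mass is split between `0` and `1` with imbalance `ε`; the other half moves from
the point `2` (at `q = 0`) to the uniform distribution on `{2, 3, 4, 5}` (at `q = 1`). -/
noncomputable def pairWeight (ε q : ℝ) : ℕ → ℝ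
  | 0 => (1 + ε) / 4
  | 1 => (1 - ε) / 4
  | 2 => 1 / 2 - 3 * q / 8
  | 3 => q / 8
  | 4 => q / 8
  | 5 => q / 8
  | _ => 0

theorem pairWeight_eq_zero {ε q : ℝ} {i : ℕ} (hi : i ∉ Finset.range 6) : pairWeight ε q i = 0 := by
  obtain ⟨k, rfl⟩ : ∃ k, i = k + 6 := ⟨i - 6, by simp at hi; omega⟩
  rfl

theorem pairWeight_neg_add_two (ε q : ℝ) (i : ℕ) :
    pairWeight (-ε) q (i + 2) = pairWeight ε q (i + 2) := by
  rcases i with _ | _ | _ | _ | i <;> rfl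

theorem pairWeight_nonneg {ε q : ℝ} (hε : |ε| ≤ 1) (hq : q ∈ Set.Icc (0 : ℝ) 1) (i : ℕ) :
    0 ≤ pairWeight ε q i := by
  obtain ⟨h1, h2⟩ := abs_le.1 hε
  obtain ⟨h3, h4⟩ := hq
  unfold pairWeight
  split <;> linarith

theorem sum_pairWeight (ε q : ℝ) : ∑ i ∈ Finset.range 6, pairWeight ε q i = 1 := by
  simp [Finset.sum_range_succ, pairWeight]; ring

/-- The probability distribution with weights `pairWeight ε q`. -/
noncomputable def pairPMF (ε q : ℝ) (hε : |ε| ≤ 1) (hq : q ∈ Set.Icc (0 : ℝ) 1) : PMF ℕ :=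
  PMF.ofFinset (fun i => ENNReal.ofReal (pairWeight ε q i)) (Finset.range 6)
    (by rw [← ENNReal.ofReal_sum_of_nonneg fun i _ => pairWeight_nonneg hε hq i, sum_pairWeight,
      ENNReal.ofReal_one])
    (fun i hi => by rw [pairWeight_eq_zero hi, ENNReal.ofReal_zero])

section pairPMF

variable {ε q : ℝ} (hε : |ε| ≤ 1) (hq : q ∈ Set.Icc (0 : ℝ) 1)

theorem pairPMF_apply (i : ℕ) : pairPMF ε q hε hq i = ENNReal.ofReal (pairWeight ε q i) := rfl

theorem toReal_pairPMF (i : ℕ) : (pairPMF ε q hε hq i).toReal = pairWeight ε q i := by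
  rw [pairPMF_apply, ENNReal.toReal_ofReal (pairWeight_nonneg hε hq i)]

theorem pairPMF_eq_zero (i : ℕ) (hi : i ∉ Finset.range 6) : pairPMF ε q hε hq i = 0 := by
  rw [pairPMF_apply, pairWeight_eq_zero hi, ENNReal.ofReal_zero]

theorem toReal_expectedPhi_pairPMF (m : ℕ) [NeZero m] :
    (expectedPhi m (pairPMF ε q hε hq)).toReal =
      ∑ X ∈ Fintype.piFinset (fun _ : Fin m => Finset.range 6),
        (∏ t, pairWeight ε q (X t)) * (Phi m (empirical X)).toReal := by
  simp only [toReal_expectedPhi (pairPMF_eq_zero hε hq), toReal_pairPMF]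

theorem expectedPhi_pairPMF_neg (m : ℕ) [NeZero m] (hε' : |-ε| ≤ 1) :
    expectedPhi m (pairPMF (-ε) q hε' hq) = expectedPhi m (pairPMF ε q hε hq) := by
  refine expectedPhi_congr_of_equiv (Equiv.swap 0 1) fun i => ?_
  rw [pairPMF_apply, pairPMF_apply]
  congr 1
  rcases i with _ | _ | i
  · simp [pairWeight]
  · simp [pairWeight, sub_eq_add_neg]
  · rw [Equiv.swap_apply_of_ne_of_ne (by omega) (by omega), pairWeight_neg_add_two]

theorem tv_pairPMF_neg (hε0 : 0 ≤ ε) (hε' : |-ε| ≤ 1) :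
    tv (pairPMF ε q hε hq) (pairPMF (-ε) q hε' hq) = ε / 2 := by
  rw [tv, tsum_eq_sum (s := Finset.range 6)]
  · simp only [toReal_pairPMF, Finset.sum_range_succ, Finset.sum_range_zero, pairWeight]
    have h1 : (1 + ε) / 4 - (1 + -ε) / 4 = ε / 2 := by ring
    have h2 : (1 - ε) / 4 - (1 - -ε) / 4 = -(ε / 2) := by ring
    rw [h1, h2, abs_neg, abs_of_nonneg (by linarith : 0 ≤ ε / 2)]
    simp
    ring
  · intro i hi
    simp only [toReal_pairPMF, pairWeight_eq_zero hi, sub_self, abs_zero]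

theorem div_eight_le_integral_tv_add_integral_tv (hε0 : 0 ≤ ε) (hε' : |-ε| ≤ 1) {m : ℕ}
    (hm : m * ε ^ 2 ≤ 1 / 2) (est : (Fin m → ℕ) → PMF ℕ) :
    ε / 8 ≤ ∫ X, tv (est X) (pairPMF ε q hε hq) ∂(sampleLaw m (pairPMF ε q hε hq)) +
      ∫ X, tv (est X) (pairPMF (-ε) q hε' hq) ∂(sampleLaw m (pairPMF (-ε) q hε' hq)) := by
  have hε1 : ε ≤ 1 := (abs_le.1 hε).2
  have hε2 : ε ^ 2 ≤ 1 := by nlinarith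
  -- On `0` and `1` the geometric mean is `√(1 - ε²) / 4 ≥ (1 - ε²) / 4`; elsewhere the two weights
  -- agree.
  have key := tv_mul_le_integral_add_integral (m := m) (pairPMF_eq_zero hε hq)
    (pairPMF_eq_zero hε' hq) (r := fun i => if i < 2 then (1 - ε ^ 2) / 4 else pairWeight ε q i)
    (fun i _ => by
      rw [toReal_pairPMF, toReal_pairPMF]
      rcases i with _ | _ | i
      · simp only [pairWeight]; norm_num; nlinarith [sq_nonneg ε]
      · simp only [pairWeight]; norm_num; nlinarith [sq_nonneg ε]
      · rw [if_neg (by omega), sq, pairWeight_neg_add_two]) est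
  rw [tv_pairPMF_neg hε hq hε0 hε'] at key
  refine le_trans ?_ key
  have hr : ∑ i ∈ Finset.range 6, (if i < 2 then (1 - ε ^ 2) / 4 else pairWeight ε q i) =
      1 + -(ε ^ 2 / 2) := by
    simp [Finset.sum_range_succ, pairWeight]; ring
  rw [hr]
  -- Bernoulli's inequality: the power is at least `1 - m ε² / 2`.
  have hb : 3 / 4 ≤ (1 + -(ε ^ 2 / 2)) ^ m := by
    refine le_trans ?_ (one_add_mul_le_pow (by linarith) m)
    linarith
  have hb2 : 1 / 2 ≤ ((1 + -(ε ^ 2 / 2)) ^ m) ^ 2 := by nlinarith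
  nlinarith

theorem le_toReal_expectedPhi_pairPMF_one {m : ℕ} [NeZero m] (h1 : (1 : ℝ) ∈ Set.Icc (0 : ℝ) 1)
    (hm : 17 ≤ m) (hmε : m * ε ^ 2 ≤ 1 / 2) :
    2 / √m ≤ (expectedPhi m (pairPMF ε 1 hε h1)).toReal := by
  have hm' : (17 : ℝ) ≤ m := by exact_mod_cast hm
  have hw0 := pairWeight_nonneg hε h1
  have hsq := sum_prod_mul_sum_empirical_sq_le (m := m) (sum_pairWeight ε 1)
  -- The value `1/4` turns `3 - 4 ∑` into `2`. The threshold `17` just suffices: `1/17 + 3/16 +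
  -- 1/272 = 1/4`, where `ε² / 8 ≤ 1/272`.
  have hE : (1 : ℝ) / m + ∑ j ∈ Finset.range 6, pairWeight ε 1 j ^ 2 ≤ 1 / 4 := by
    have h2 : ∑ j ∈ Finset.range 6, pairWeight ε 1 j ^ 2 = 3 / 16 + ε ^ 2 / 8 := by
      simp [Finset.sum_range_succ, pairWeight]; ring
    have h3 : (1 : ℝ) / m ≤ 1 / 17 := one_div_le_one_div_of_le (by norm_num) hm'
    have h4 : 17 * ε ^ 2 ≤ 1 / 2 := by nlinarith [sq_nonneg ε]
    rw [h2]; linarith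
  rw [toReal_expectedPhi_pairPMF]
  calc 2 / √m ≤ ∑ X ∈ Fintype.piFinset (fun _ : Fin m => Finset.range 6),
        (∏ t, pairWeight ε 1 (X t)) *
          ((3 - 4 * ∑ j ∈ Finset.range 6, (empirical X j).toReal ^ 2) / √m) := by
        simp only [← mul_div_assoc]
        rw [← Finset.sum_div]
        gcongr
        simp only [mul_sub, Finset.sum_sub_distrib, mul_left_comm _ (4 : ℝ)]
        rw [← Finset.mul_sum, ← Finset.sum_mul, sum_piFinset_prod, sum_pairWeight, one_pow]
        linarith
    _ ≤ _ := by
        refine Finset.sum_le_sum fun X hX => mul_le_mul_of_nonneg_left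
          (le_toReal_Phi_empirical (Fintype.mem_piFinset.1 hX))
          (Finset.prod_nonneg fun t _ => hw0 _)

/-- At `q = 0` only three atoms remain, so the Cauchy–Schwarz bound on `Phi` applies with
cardinality `3`. -/
theorem toReal_expectedPhi_pairPMF_zero_le {m : ℕ} [NeZero m]
    (h0 : (0 : ℝ) ∈ Set.Icc (0 : ℝ) 1) :
    (expectedPhi m (pairPMF ε 0 hε h0)).toReal ≤ √3 / √m := by
  have hz : ∀ i ∉ Finset.range 3, pairPMF ε 0 hε h0 i = 0 := by
    intro i hi
    rw [pairPMF_apply]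
    rcases i with _ | _ | _ | _ | _ | _ | i <;> simp [pairWeight] at hi ⊢
  have hsum : ∑ i ∈ Finset.range 3, pairWeight ε 0 i = 1 := by
    simp [Finset.sum_range_succ, pairWeight]; ring
  rw [toReal_expectedPhi hz]
  simp only [toReal_pairPMF]
  calc _ ≤ ∑ X ∈ Fintype.piFinset (fun _ : Fin m => Finset.range 3),
        (∏ t, pairWeight ε 0 (X t)) * (√3 / √m) := by
        refine Finset.sum_le_sum fun X hX => mul_le_mul_of_nonneg_left ?_
          (Finset.prod_nonneg fun t _ => pairWeight_nonneg hε h0 _)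
        simpa using toReal_Phi_empirical_le (Fintype.mem_piFinset.1 hX)
    _ = _ := by rw [← Finset.sum_mul, sum_piFinset_prod, hsum, one_pow, one_mul]

theorem exists_toReal_expectedPhi_pairPMF_eq {m : ℕ} [NeZero m] (hm : 17 ≤ m)
    (hmε : m * ε ^ 2 ≤ 1 / 2) {x : ℝ} (hx : x ∈ Set.Icc (√3 / √m) (2 / √m)) :
    ∃ (q : ℝ) (hq : q ∈ Set.Icc (0 : ℝ) 1), (expectedPhi m (pairPMF ε q hε hq)).toReal = x := by
  have h0 : (0 : ℝ) ∈ Set.Icc (0 : ℝ) 1 := by simp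
  have h1 : (1 : ℝ) ∈ Set.Icc (0 : ℝ) 1 := by simp
  set g : ℝ → ℝ := fun q => ∑ X ∈ Fintype.piFinset (fun _ : Fin m => Finset.range 6),
        (∏ t, pairWeight ε q (X t)) * (Phi m (empirical X)).toReal
  have hg : Continuous g := by
    refine continuous_finsetSum _ fun X _ => (continuous_finsetProd _ fun t _ => ?_).mul
      continuous_const
    unfold pairWeight
    split <;> fun_prop
  have hlow := toReal_expectedPhi_pairPMF_zero_le hε (m := m) h0
  have hhigh := le_toReal_expectedPhi_pairPMF_one hε h1 hm hmε
  rw [toReal_expectedPhi_pairPMF] at hlow hhigh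
  obtain ⟨q, hq, hqx⟩ := intermediate_value_Icc zero_le_one hg.continuousOn
    (show x ∈ Set.Icc (g 0) (g 1) from ⟨hlow.trans hx.1, hx.2.trans hhigh⟩)
  exact ⟨q, hq, by rw [toReal_expectedPhi_pairPMF]; exact hqx⟩

end pairPMF

/-! ### Choice of parameters and conclusion -/

theorem div_sixtyfour_le (est : (m : ℕ) → (Fin m → ℕ) → PMF ℕ) (Ψ : ℕ → PMF ℕ → ℝ) (θ : ℝ≥0 → ℝ≥0)
    (h : ∀ (m : ℕ) [NeZero m] (μ : PMF ℕ),
      ∫ X, tv (est m X) μ ∂(sampleLaw m μ) ≤ ∫ X, Ψ m (est m X) ∂(sampleLaw m μ) ∧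
      ∫ X, Ψ m (est m X) ∂(sampleLaw m μ) ≤ (θ (expectedPhi m μ).toNNReal : ℝ))
    {x : ℝ≥0} (hx0 : 0 < x) (hxb : (x : ℝ) < 1 / 4) : (x : ℝ) / 64 ≤ θ x := by
  have hx0' : (0 : ℝ) < x := hx0
  -- This gives `3 ≤ m x² ≤ 4`, the room for rounding being `x² ≤ 1`; hence `√3/√m ≤ x ≤ 2/√m`, and
  -- `x² ≤ 1/16` ensures `m ≥ 17`.
  set m := ⌈3 / (x : ℝ) ^ 2⌉₊
  have hmge : 3 / (x : ℝ) ^ 2 ≤ m := Nat.le_ceil _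
  have hmlt : (m : ℝ) < 3 / (x : ℝ) ^ 2 + 1 := Nat.ceil_lt_add_one (by positivity)
  have hx2 : (x : ℝ) ^ 2 ≤ 1 / 16 := by nlinarith
  have h3 : 3 ≤ m * (x : ℝ) ^ 2 := (div_le_iff₀ (by positivity)).1 hmge
  have h4 : m * (x : ℝ) ^ 2 ≤ 4 := by
    have := mul_lt_mul_of_pos_right hmlt (by positivity : (0 : ℝ) < (x : ℝ) ^ 2)
    rw [add_mul, div_mul_cancel₀ _ (by positivity)] at this
    linarith
  have hm17 : 17 ≤ m := by
    have : (17 : ℝ) ≤ m := by nlinarith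
    exact_mod_cast this
  have : NeZero m := ⟨by omega⟩
  have hm0 : (0 : ℝ) < m := by positivity
  have hsm : 0 < √(m : ℝ) := Real.sqrt_pos.2 hm0
  have hmε : m * ((1 / 4 : ℝ) * x) ^ 2 ≤ 1 / 2 := by nlinarith
  have hε0 : 0 ≤ (1 / 4 : ℝ) * x := by positivity
  have hε : |(1 / 4 : ℝ) * x| ≤ 1 := by rw [abs_of_nonneg hε0]; linarith
  have hε' : |-((1 / 4 : ℝ) * x)| ≤ 1 := by rwa [abs_neg]
  obtain ⟨q, hq, hqx⟩ := exists_toReal_expectedPhi_pairPMF_eq hε hm17 hmε (x := x) ⟨by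
      rw [div_le_iff₀ hsm, ← Real.sqrt_sq hx0'.le, ← Real.sqrt_mul (sq_nonneg _)]
      exact Real.sqrt_le_sqrt (by linarith), by
      rw [le_div_iff₀ hsm, ← Real.sqrt_sq hx0'.le, ← Real.sqrt_mul (sq_nonneg _),
        Real.sqrt_le_left (by norm_num)]
      linarith⟩
  have hqx' : (expectedPhi m (pairPMF ((1 / 4 : ℝ) * x) q hε hq)).toNNReal = x :=
    NNReal.coe_injective hqx
  have hlow := div_eight_le_integral_tv_add_integral_tv hε hq hε0 hε' hmε (est m)
  have hp := h m (pairPMF ((1 / 4 : ℝ) * x) q hε hq)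
  have hn := h m (pairPMF (-((1 / 4 : ℝ) * x)) q hε' hq)
  rw [expectedPhi_pairPMF_neg hε hq m hε'] at hn
  rw [hqx'] at hp hn
  -- Adding both risk bounds: `x/32 = ε/8 ≤ 2 θ(x)`.
  linarith [hp.1, hp.2, hn.1, hn.2]

end TVEstimation

theorem theorem4 :
    ∃ a b : ℝ, 0 < a ∧ 0 < b ∧
      ∀ (est : (m : ℕ) → (Fin m → ℕ) → PMF ℕ) (Ψ : ℕ → PMF ℕ → ℝ) (θ : ℝ≥0 → ℝ≥0),
        Continuous θ →
        (∀ (m : ℕ) [NeZero m] (μ : PMF ℕ),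
          Integrable (fun X => Ψ m (est m X)) (TVEstimation.sampleLaw m μ) ∧
          ∫ X, TVEstimation.tv (est m X) μ ∂(TVEstimation.sampleLaw m μ)
            ≤ ∫ X, Ψ m (est m X) ∂(TVEstimation.sampleLaw m μ) ∧
          ∫ X, Ψ m (est m X) ∂(TVEstimation.sampleLaw m μ)
            ≤ (θ (TVEstimation.expectedPhi m μ).toNNReal : ℝ)) →
        1 / a ≤ ⨅ x : {x : ℝ≥0 // 0 < x ∧ (x : ℝ) < b}, (θ x : ℝ) / ((x : ℝ≥0) : ℝ) := by
  refine ⟨64, 1 / 4, by norm_num, by norm_num, fun est Ψ θ _ h => ?_⟩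
  have : Nonempty {x : ℝ≥0 // 0 < x ∧ (x : ℝ) < 1 / 4} :=
    ⟨⟨1 / 8, by positivity, by norm_num⟩⟩
  refine le_ciInf fun ⟨x, hx0, hxb⟩ => ?_
  rw [le_div_iff₀ (by exact_mod_cast hx0)]
  have := TVEstimation.div_sixtyfour_le est Ψ θ (fun m _ μ => (h m μ).2) hx0 hxb
  linarith
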